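/- Lemma 5.1. Let $\mathcal T^d=(\mathbb R/\mathbb Z)^d$ be the $d$-dimensional torus with $|\mathcal T^d|=1$, let $\kappa>0$, $c\ge 0$, and let the reaction coefficient $k=k(t,x)$ (which may depend on $(t,x)$ also through the solution) satisfy $0<\underline k\le k\le\overline k$ with constants $\underline k,\overline k$. Let $(n,p,e)$ be a global classical solution of $$\partial_t n=\kappa\Delta n+k(e-np),\qquad \partial_t p=\kappa\Delta p+k(e-np),\qquad \partial_t e=\kappa\Delta e$$ on $\mathcal T^d$ with initial data $(n_0,p_0,e_0)\in L^\infty(\mathcal T^d)^3$; that is, $n,p,e$ are of class $C^{1,2}$ on $(0,\infty)\times\mathcal T^d$, bounded on $(0,T]\times\mathcal T^d$ for every $T<\infty$, satisfy the equations pointwise for $t>0$, and converge in $L^1(\mathcal T^d)$ to $n_0,p_0,e_0$ as $t\to0^+$. Assume that $n_0,p_0\ge0$ and $0<\underline e\le e_0\le\overline e$ almost everywhere with constants $\underline e,\overline e$, and put $$\int_{\mathcal T^d}(n_0-p_0)\,dx=\mathbf C_0,\qquad \int_{\mathcal T^d}e_0\,dx=E_0=:e^*.$$ Let $C_n,C_p>0$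 be determined by $C_nC_p=1$ and $C_n-C_p=\mathbf C_0/\sqrt{e^*}$, and assume that the initial relative entropy $\mathcal H(n_0,p_0,e_0)$ is finite, where, with $\lambda_B(\nu)=\nu\ln\nu-\nu+1$ and $\lambda_B(0)=1$, $$\mathcal H(n,p,e)=\int_{\mathcal T^d}\Big( C_n\sqrt e\,\lambda_B\big(\tfrac{n}{C_n\sqrt e}\big)+C_p\sqrt e\,\lambda_B\big(\tfrac{p}{C_p\sqrt e}\big)+\tfrac{c+C_n+C_p}{2\sqrt{e^*}}\big(\sqrt e-\sqrt{e^*}\big)^2\Big)dx .$$ Then $$\sup_{t\ge0}\big(\|n(t)\|_{L^1(\mathcal T^d)}+\|p(t)\|_{L^1(\mathcal T^d)}\big)<\infty .$$ -/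

import Mathlib

open MeasureTheory Set Filter Topology

/-- The `d`-dimensional torus `(ℝ/ℤ)^d`; its `volume` is the normalized Haar measure, so that the
torus has measure one. -/
abbrev Torus (d : ℕ) : Type := UnitAddTorus (Fin d)

theorem torus_volume_univ (d : ℕ) : volume (univ : Set (Torus d)) = 1 := by
  rw [volume_pi, Measure.pi_univ]
  simp

/-- The translate `x + s eᵢ` of a point `x` of the torus in the `i`-th coordinate direction. -/
noncomputable def torusShift {d : ℕ} (i : Fin d) (x : Torus d) (s : ℝ) : Torus d :=
  x + Pi.single i (s : UnitAddCircle)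

/-- The `i`-th partial derivative of a function on the torus. -/
noncomputable def torusPartial {d : ℕ} (i : Fin d) (f : Torus d → ℝ) (x : Torus d) : ℝ :=
  deriv (fun s : ℝ => f (torusShift i x s)) 0

/-- The Laplacian `Δf = ∑ᵢ ∂ᵢ∂ᵢf` on the torus. -/
noncomputable def torusLaplacian {d : ℕ} (f : Torus d → ℝ) (x : Torus d) : ℝ :=
  ∑ i, torusPartial i (torusPartial i f) x

/-- `u ∈ C^{1,2}((0,∞) × T^d)`: the derivatives `∂ₜu`, `∂ᵢu`, `∂ᵢ∂ⱼu` exist at all positive times,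
and together with `u` they are jointly continuous on `(0,∞) × T^d`. -/
structure IsC12 {d : ℕ} (u : ℝ → Torus d → ℝ) : Prop where
  diff_t : ∀ t > 0, ∀ x, DifferentiableAt ℝ (fun s => u s x) t
  diff_x : ∀ t > 0, ∀ x, ∀ i : Fin d,
    DifferentiableAt ℝ (fun s : ℝ => u t (torusShift i x s)) 0
  diff_xx : ∀ t > 0, ∀ x, ∀ i j : Fin d,
    DifferentiableAt ℝ (fun s : ℝ => torusPartial j (u t) (torusShift i x s)) 0
  cont : ContinuousOn (fun z : ℝ × Torus d => u z.1 z.2) (Ioi 0 ×ˢ univ)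
  cont_t : ContinuousOn (fun z : ℝ × Torus d => deriv (fun s => u s z.2) z.1) (Ioi 0 ×ˢ univ)
  cont_x : ∀ i : Fin d,
    ContinuousOn (fun z : ℝ × Torus d => torusPartial i (u z.1) z.2) (Ioi 0 ×ˢ univ)
  cont_xx : ∀ i j : Fin d,
    ContinuousOn (fun z : ℝ × Torus d => torusPartial i (torusPartial j (u z.1)) z.2)
      (Ioi 0 ×ˢ univ)

/-- The regularity class of one component of a global classical solution whose initial value `u 0`
is merely bounded: `u` is `C^{1,2}` at positive times, bounded on `(0,T] × T^d` for every finite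
`T`, and takes its initial value in the sense of `L¹`. -/
structure IsClassicalComponent {d : ℕ} (u : ℝ → Torus d → ℝ) : Prop where
  regular : IsC12 u
  locally_bounded : ∀ T : ℝ, ∃ M : ℝ, ∀ t ∈ Ioc 0 T, ∀ x, |u t x| ≤ M
  initial : Tendsto (fun t => eLpNorm (fun x => u t x - u 0 x) 1 volume) (𝓝[>] 0) (𝓝 0)

/-- `(n, p, e)` is a global classical solution, with initial value `(n 0, p 0, e 0)`, of
`∂ₜn = κΔn + k(e - np)`, `∂ₜp = κΔp + k(e - np)`, `∂ₜe = κΔe` on the torus.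
Here `k t x` is the value of the reaction coefficient at `(t, x)`; a coefficient `K(x, n, p, e)` is
the case `k t x = K x (n t x) (p t x) (e t x)`. No sign of `n`, `p`, `e` is presupposed. -/
structure IsGlobalSolution {d : ℕ} (κ : ℝ) (k n p e : ℝ → Torus d → ℝ) : Prop where
  comp_n : IsClassicalComponent n
  comp_p : IsClassicalComponent p
  comp_e : IsClassicalComponent e
  eq_n : ∀ t > 0, ∀ x, deriv (fun s => n s x) t =
    κ * torusLaplacian (n t) x + k t x * (e t x - n t x * p t x)
  eq_p : ∀ t > 0, ∀ x, deriv (fun s => p s x) t =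
    κ * torusLaplacian (p t) x + k t x * (e t x - n t x * p t x)
  eq_e : ∀ t > 0, ∀ x, deriv (fun s => e s x) t = κ * torusLaplacian (e t) x

/-- The Boltzmann function `λ_B(ν) = ν log ν - ν + 1`, with `λ_B(0) = 1`. -/
noncomputable def boltzmann (ν : ℝ) : ℝ := ν * Real.log ν - ν + 1

/-- The relative entropy with respect to the constant state `(Cn √eStar, Cp √eStar, eStar)`:
the integral over the torus of
`w_n λ_B(n / w_n) + w_p λ_B(p / w_p) + (c + Cn + Cp) / (2 √eStar) (√e - √eStar)²`
with `w_n = Cn √e` and `w_p = Cp √e`. The integrand is nonnegative for nonnegative `n`, `p` and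
positive `e`, so that the integral is an element of `[0, ∞]`. -/
noncomputable def relEntropy {d : ℕ} (c Cn Cp eStar : ℝ) (n p e : Torus d → ℝ) : ENNReal :=
  ∫⁻ x, ENNReal.ofReal
    (Cn * √(e x) * boltzmann (n x / (Cn * √(e x))) +
      Cp * √(e x) * boltzmann (p x / (Cp * √(e x))) +
      (c + Cn + Cp) / (2 * √eStar) * (√(e x) - √eStar) ^ 2)

/-!
The maximum principle bounds `n` and `p` uniformly in time and space. It preserves `e ≥ 0`, hence
`n, p ≥ 0`, and also the initial upper bound `B` of `e`. The difference `n - p` solves the heat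
equation and is initially at most `n 0 ≤ A`, so `n - p ≤ A` forever. Where `n > A + √B` we get
`p ≥ n - A > √B`, so `n p > B ≥ e` and the reaction can only decrease `n`; hence `n` never exceeds
`A + √B`. The roles of `n` and `p` are symmetric.

As the initial values are attained only in `L¹`, the maximum principle is proved by truncation: the
integral of `(u - K)⁺ ^ 3` satisfies a Grönwall inequality for positive times and tends to zero as
`t → 0⁺`.
-/

section CompactSpace

variable {X E : Type*} [TopologicalSpace X] [CompactSpace X] [MeasurableSpace X]
  [OpensMeasurableSpace X] [NormedAddCommGroup E] {μ : Measure X} [IsFiniteMeasureOnCompacts μ]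

theorem integrable_of_continuous_of_compactSpace {f : X → E} (hf : Continuous f) :
    Integrable f μ :=
  hf.integrable_of_hasCompactSupport (HasCompactSupport.of_compactSpace f)

theorem hasDerivAt_integral_of_continuousOn_of_compactSpace [NormedSpace ℝ E] {F F' : ℝ → X → E}
    {U : Set ℝ} (hU : IsOpen U)
    (hF : ContinuousOn (fun z : ℝ × X => F z.1 z.2) (U ×ˢ univ))
    (hF' : ContinuousOn (fun z : ℝ × X => F' z.1 z.2) (U ×ˢ univ))
    (hFF' : ∀ s ∈ U, ∀ x, HasDerivAt (fun r => F r x) (F' s x) s) {t : ℝ} (ht : t ∈ U) :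
    HasDerivAt (fun s => ∫ x, F s x ∂μ) (∫ x, F' t x ∂μ) t := by
  have integrable_slice {G : ℝ → X → E}
      (hG : ContinuousOn (fun z : ℝ × X => G z.1 z.2) (U ×ˢ univ)) {s : ℝ} (hs : s ∈ U) :
      Integrable (G s) μ :=
    integrable_of_continuous_of_compactSpace <|
      hG.comp_continuous (by fun_prop : Continuous fun x => (s, x)) fun x => ⟨hs, mem_univ x⟩
  obtain ⟨N, hN, hNU, hNc⟩ := local_compact_nhds (hU.mem_nhds ht)
  obtain ⟨C, hC⟩ := (hNc.prod isCompact_univ).exists_bound_of_continuousOn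
    (hF'.mono (prod_mono_left hNU))
  have : IsFiniteMeasure μ := ⟨isCompact_univ.measure_lt_top⟩
  exact (hasDerivAt_integral_of_dominated_loc_of_deriv_le (bound := fun _ => C) hN
    (eventually_of_mem (hU.mem_nhds ht) fun s hs => (integrable_slice hF hs).1)
    (integrable_slice hF ht) (integrable_slice hF' ht).1
    (ae_of_all _ fun x s hs => hC (s, x) ⟨hs, mem_univ x⟩) (integrable_const C)
    (ae_of_all _ fun x s hs => hFF' s (hNU hs) x)).2

end CompactSpace

theorem nonpos_of_hasDerivAt_le_mul_of_tendsto_zero {y y' : ℝ → ℝ} {C a t : ℝ} (hat : a < t)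
    (hy : ∀ s ∈ Ioc a t, HasDerivAt y (y' s) s) (hle : ∀ s ∈ Ioc a t, y' s ≤ C * y s)
    (hlim : Tendsto y (𝓝[>] a) (𝓝 0)) : y t ≤ 0 := by
  have gronwall : ∀ s ∈ Ioo a t, y t ≤ y s * Real.exp (C * (t - s)) := fun s hs => by
    rw [← gronwallBound_ε0]
    exact le_gronwallBound_of_liminf_deriv_right_le
      (fun r hr => (hy r ⟨hs.1.trans_le hr.1, hr.2⟩).continuousAt.continuousWithinAt)
      (fun r hr _ => (hy r ⟨hs.1.trans_le hr.1, hr.2.le⟩).hasDerivWithinAt.liminf_right_slope_le)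
      le_rfl (fun r hr => by simpa using hle r ⟨hs.1.trans_le hr.1, hr.2.le⟩)
      t (right_mem_Icc.2 hs.2.le)
  have hexp : Tendsto (fun s => Real.exp (C * (t - s))) (𝓝[>] a) (𝓝 (Real.exp (C * (t - a)))) :=
    (Continuous.tendsto (by fun_prop) a).mono_left nhdsWithin_le_nhds
  exact ge_of_tendsto (by simpa using hlim.mul hexp)
    (eventually_of_mem (Ioo_mem_nhdsGT hat) gronwall)

theorem hasDerivAt_posPart_pow (m : ℕ) (s : ℝ) :
    HasDerivAt (fun r : ℝ => r⁺ ^ (m + 2)) ((m + 2) * s⁺ ^ (m + 1)) s := by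
  refine hasDerivAt_of_hasDerivAt_of_ne' (x := 0) (g := fun r : ℝ => (m + 2) * r⁺ ^ (m + 1))
    (fun r hr => ?_) (continuous_posPart.fun_pow _).continuousAt
    ((continuous_posPart.fun_pow _).const_mul _).continuousAt s
  rcases hr.lt_or_gt with hr | hr
  · have hzero : (fun r : ℝ => r⁺ ^ (m + 2)) =ᶠ[𝓝 r] fun _ => 0 := by
      filter_upwards [Iio_mem_nhds hr] with q hq
      simp [posPart_of_nonpos (mem_Iio.1 hq).le]
    simpa [posPart_of_nonpos hr.le] using (hasDerivAt_const r (0 : ℝ)).congr_of_eventuallyEq hzero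
  · have hpow : (fun r : ℝ => r⁺ ^ (m + 2)) =ᶠ[𝓝 r] fun r => r ^ (m + 2) := by
      filter_upwards [Ioi_mem_nhds hr] with q hq
      rw [posPart_of_nonneg (mem_Ioi.1 hq).le]
    simpa [posPart_of_nonneg hr.le] using (hasDerivAt_pow (m + 2) r).congr_of_eventuallyEq hpow

section Torus

variable {d : ℕ} {i : Fin d} {f g : Torus d → ℝ}

theorem torusShift_zero (i : Fin d) (x : Torus d) : torusShift i x 0 = x := by
  rw [torusShift, AddCircle.coe_zero, Pi.single_zero, add_zero]

theorem torusShift_add (i : Fin d) (x : Torus d) (s h : ℝ) :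
    torusShift i x (s + h) = torusShift i (torusShift i x s) h := by
  simp only [torusShift, AddCircle.coe_add, Pi.single_add, add_assoc]

theorem continuous_torusShift (i : Fin d) :
    Continuous fun z : ℝ × Torus d => torusShift i z.2 z.1 :=
  continuous_snd.add <| (continuous_single i).comp <|
    (AddCircle.continuous_mk' 1).comp continuous_fst

theorem torusPartial_neg (i : Fin d) (f : Torus d → ℝ) :
    torusPartial i (fun x => -f x) = fun x => -torusPartial i f x :=
  funext fun _ => deriv.fun_neg

theorem torusLaplacian_neg (f : Torus d → ℝ) (x : Torus d) :
    torusLaplacian (fun x => -f x) x = -torusLaplacian f x := by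
  simp only [torusLaplacian, torusPartial_neg, Finset.sum_neg_distrib]

/-- A function on the torus which is continuously differentiable in the `i`-th coordinate
direction. As the base point varies, it is enough to ask for the derivative at shift `0`. -/
structure IsC1Along (i : Fin d) (f : Torus d → ℝ) : Prop where
  continuous : Continuous f
  differentiableAt : ∀ x, DifferentiableAt ℝ (fun s : ℝ => f (torusShift i x s)) 0
  continuous_torusPartial : Continuous (torusPartial i f)

namespace IsC1Along

theorem hasDerivAt_torusShift (hf : IsC1Along i f) (x : Torus d) (s : ℝ) :
    HasDerivAt (fun r : ℝ => f (torusShift i x r)) (torusPartial i f (torusShift i x s)) s := by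
  have h : HasDerivAt (fun r : ℝ => f (torusShift i (torusShift i x s) r))
      (torusPartial i f (torusShift i x s)) (s - s) := by
    rw [sub_self]
    exact (hf.differentiableAt _).hasDerivAt
  simpa only [← torusShift_add, add_sub_cancel] using h.comp_sub_const s s

theorem integral_torusPartial (hf : IsC1Along i f) : ∫ x, torusPartial i f x = 0 := by
  have hderiv := hasDerivAt_integral_of_continuousOn_of_compactSpace (μ := volume) isOpen_univ
    (hf.continuous.comp (continuous_torusShift i)).continuousOn
    (hf.continuous_torusPartial.comp (continuous_torusShift i)).continuousOn
    (fun s _ x => hf.hasDerivAt_torusShift x s) (mem_univ 0)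
  have translation_invariant : (fun s : ℝ => ∫ x, f (torusShift i x s)) = fun _ => ∫ x, f x :=
    funext fun s => integral_add_right_eq_self f _
  simp only [torusShift_zero, translation_invariant] at hderiv
  exact hderiv.unique (hasDerivAt_const _ _)

theorem of_hasDerivAt {f' : Torus d → ℝ} (hf : Continuous f) (hf' : Continuous f')
    (h : ∀ x, HasDerivAt (fun s : ℝ => f (torusShift i x s)) (f' x) 0) : IsC1Along i f where
  continuous := hf
  differentiableAt x := (h x).differentiableAt
  continuous_torusPartial := by rwa [show torusPartial i f = f' from funext fun x => (h x).deriv]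

theorem hasDerivAt_mul (hf : IsC1Along i f) (hg : IsC1Along i g) (x : Torus d) :
    HasDerivAt (fun s : ℝ => f (torusShift i x s) * g (torusShift i x s))
      (torusPartial i f x * g x + f x * torusPartial i g x) 0 := by
  simpa only [torusShift_zero] using
    (hf.hasDerivAt_torusShift x 0).fun_mul (hg.hasDerivAt_torusShift x 0)

theorem integral_mul_torusPartial (hf : IsC1Along i f) (hg : IsC1Along i g) :
    ∫ x, f x * torusPartial i g x = -∫ x, torusPartial i f x * g x := by
  have cf := hf.continuous
  have cg := hg.continuous
  have cf' := hf.continuous_torusPartial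
  have cg' := hg.continuous_torusPartial
  have hfg : IsC1Along i fun x => f x * g x :=
    of_hasDerivAt (by fun_prop) (by fun_prop) (hf.hasDerivAt_mul hg)
  have product_rule : torusPartial i (fun x => f x * g x) =
      fun x => torusPartial i f x * g x + f x * torusPartial i g x :=
    funext fun x => (hf.hasDerivAt_mul hg x).deriv
  have hzero := hfg.integral_torusPartial
  rw [product_rule, integral_add (integrable_of_continuous_of_compactSpace (by fun_prop))
    (integrable_of_continuous_of_compactSpace (by fun_prop))] at hzero
  exact (neg_eq_of_add_eq_zero_right hzero).symm

theorem hasDerivAt_comp (hf : IsC1Along i f) {ψ ψ' : ℝ → ℝ} (hψ : ∀ s, HasDerivAt ψ (ψ' s) s)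
    (x : Torus d) :
    HasDerivAt (fun s : ℝ => ψ (f (torusShift i x s))) (ψ' (f x) * torusPartial i f x) 0 := by
  simpa only [torusShift_zero, Function.comp_def] using
    (hψ _).comp (0 : ℝ) (hf.hasDerivAt_torusShift x 0)

end IsC1Along

theorem integral_comp_mul_torusPartial_torusPartial_nonpos (hf : IsC1Along i f)
    (hf' : IsC1Along i (torusPartial i f)) {ψ ψ' : ℝ → ℝ} (hψ : ∀ s, HasDerivAt ψ (ψ' s) s)
    (hψ' : Continuous ψ') (hψ'_nonneg : ∀ s, 0 ≤ ψ' s) :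
    ∫ x, ψ (f x) * torusPartial i (torusPartial i f) x ≤ 0 := by
  have cf := hf.continuous
  have cf' := hf.continuous_torusPartial
  have cψ : Continuous ψ := continuous_iff_continuousAt.2 fun s => (hψ s).continuousAt
  have hψf : IsC1Along i fun x => ψ (f x) :=
    .of_hasDerivAt (by fun_prop) (by fun_prop) (hf.hasDerivAt_comp hψ)
  have chain_rule : torusPartial i (fun x => ψ (f x)) = fun x => ψ' (f x) * torusPartial i f x :=
    funext fun x => (hf.hasDerivAt_comp hψ x).deriv
  rw [hψf.integral_mul_torusPartial hf', chain_rule, neg_nonpos]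
  simp only [mul_assoc]
  exact integral_nonneg fun x => mul_nonneg (hψ'_nonneg _) (mul_self_nonneg _)

theorem integral_comp_mul_torusLaplacian_nonpos (hf : ∀ i, IsC1Along i f)
    (hf' : ∀ i, IsC1Along i (torusPartial i f)) {ψ ψ' : ℝ → ℝ} (hψ : ∀ s, HasDerivAt ψ (ψ' s) s)
    (hψ' : Continuous ψ') (hψ'_nonneg : ∀ s, 0 ≤ ψ' s) :
    ∫ x, ψ (f x) * torusLaplacian f x ≤ 0 := by
  have cψ : Continuous ψ := continuous_iff_continuousAt.2 fun s => (hψ s).continuousAt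
  simp only [torusLaplacian, Finset.mul_sum]
  rw [integral_finsetSum _ fun i _ => ?integrable]
  case integrable =>
    exact integrable_of_continuous_of_compactSpace
      ((cψ.comp (hf i).continuous).mul (hf' i).continuous_torusPartial)
  exact Finset.sum_nonpos fun i _ =>
    integral_comp_mul_torusPartial_torusPartial_nonpos (hf i) (hf' i) hψ hψ' hψ'_nonneg

/-- The cubic energy of the part of `f` above the level `K`, used to prove the maximum principle.
The cube makes the density twice continuously differentiable in `f`. -/
noncomputable def excessEnergy (K : ℝ) (f : Torus d → ℝ) : ℝ := ∫ x, (f x - K)⁺ ^ 3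

theorem le_of_excessEnergy_nonpos {K : ℝ} (hf : Continuous f) (h : excessEnergy K f ≤ 0)
    (x : Torus d) : f x ≤ K := by
  have hc : Continuous fun x => (f x - K)⁺ ^ 3 := (continuous_posPart.comp (by fun_prop)).pow 3
  have hnonneg : 0 ≤ fun x => (f x - K)⁺ ^ 3 := fun x => by positivity
  have hae := (integral_eq_zero_iff_of_nonneg hnonneg
    (integrable_of_continuous_of_compactSpace hc)).1 (h.antisymm (integral_nonneg hnonneg))
  have hzero := congrFun ((Continuous.ae_eq_iff_eq volume hc continuous_zero).1 hae) x
  exact sub_nonpos.1 (posPart_eq_zero.1 (eq_zero_of_pow_eq_zero hzero))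

end Torus

namespace IsC12

variable {d : ℕ} {u v : ℝ → Torus d → ℝ} {t : ℝ}

theorem continuous_slice {F : ℝ × Torus d → ℝ} (hF : ContinuousOn F (Ioi 0 ×ˢ univ))
    (ht : 0 < t) : Continuous fun x => F (t, x) :=
  hF.comp_continuous (by fun_prop) fun x => ⟨ht, mem_univ x⟩

theorem continuous (hu : IsC12 u) (ht : 0 < t) : Continuous (u t) :=
  continuous_slice hu.cont ht

theorem isC1Along (hu : IsC12 u) (ht : 0 < t) (i : Fin d) : IsC1Along i (u t) :=
  ⟨hu.continuous ht, fun x => hu.diff_x t ht x i, continuous_slice (hu.cont_x i) ht⟩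

theorem isC1Along_torusPartial (hu : IsC12 u) (ht : 0 < t) (i j : Fin d) :
    IsC1Along i (torusPartial j (u t)) :=
  ⟨continuous_slice (hu.cont_x j) ht, fun x => hu.diff_xx t ht x i j,
    continuous_slice (hu.cont_xx i j) ht⟩

theorem continuous_torusLaplacian (hu : IsC12 u) (ht : 0 < t) : Continuous (torusLaplacian (u t)) :=
  continuous_finsetSum _ fun i _ => (hu.isC1Along_torusPartial ht i i).continuous_torusPartial

theorem neg (hu : IsC12 u) : IsC12 fun t x => -u t x where
  diff_t t ht x := (hu.diff_t t ht x).fun_neg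
  diff_x t ht x i := (hu.diff_x t ht x i).fun_neg
  diff_xx t ht x i j := by simpa only [torusPartial_neg] using (hu.diff_xx t ht x i j).fun_neg
  cont := hu.cont.fun_neg
  cont_t := by simpa only [deriv.fun_neg] using hu.cont_t.fun_neg
  cont_x i := by simpa only [torusPartial_neg] using (hu.cont_x i).fun_neg
  cont_xx i j := by simpa only [torusPartial_neg] using (hu.cont_xx i j).fun_neg

theorem deriv_sub (hu : IsC12 u) (hv : IsC12 v) (ht : 0 < t) (x : Torus d) :
    deriv (fun s => u s x - v s x) t = deriv (fun s => u s x) t - deriv (fun s => v s x) t :=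
  deriv_fun_sub (hu.diff_t t ht x) (hv.diff_t t ht x)

theorem torusPartial_sub (hu : IsC12 u) (hv : IsC12 v) (ht : 0 < t) (i : Fin d) :
    torusPartial i (fun x => u t x - v t x) =
      fun x => torusPartial i (u t) x - torusPartial i (v t) x :=
  funext fun x => deriv_fun_sub (hu.diff_x t ht x i) (hv.diff_x t ht x i)

theorem torusPartial_torusPartial_sub (hu : IsC12 u) (hv : IsC12 v) (ht : 0 < t) (i j : Fin d) :
    torusPartial i (torusPartial j fun x => u t x - v t x) = fun x =>
      torusPartial i (torusPartial j (u t)) x - torusPartial i (torusPartial j (v t)) x := by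
  rw [hu.torusPartial_sub hv ht]
  exact funext fun x => deriv_fun_sub (hu.diff_xx t ht x i j) (hv.diff_xx t ht x i j)

theorem torusLaplacian_sub (hu : IsC12 u) (hv : IsC12 v) (ht : 0 < t) (x : Torus d) :
    torusLaplacian (fun x => u t x - v t x) x =
      torusLaplacian (u t) x - torusLaplacian (v t) x := by
  simp only [torusLaplacian, hu.torusPartial_torusPartial_sub hv ht, Finset.sum_sub_distrib]

theorem sub (hu : IsC12 u) (hv : IsC12 v) : IsC12 fun t x => u t x - v t x where
  diff_t t ht x := (hu.diff_t t ht x).fun_sub (hv.diff_t t ht x)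
  diff_x t ht x i := (hu.diff_x t ht x i).fun_sub (hv.diff_x t ht x i)
  diff_xx t ht x i j := by
    simpa only [hu.torusPartial_sub hv ht] using
      (hu.diff_xx t ht x i j).fun_sub (hv.diff_xx t ht x i j)
  cont := hu.cont.fun_sub hv.cont
  cont_t := (hu.cont_t.fun_sub hv.cont_t).congr fun z hz => hu.deriv_sub hv hz.1 z.2
  cont_x i := ((hu.cont_x i).fun_sub (hv.cont_x i)).congr fun z hz =>
    congrFun (hu.torusPartial_sub hv hz.1 i) z.2
  cont_xx i j := ((hu.cont_xx i j).fun_sub (hv.cont_xx i j)).congr fun z hz =>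
    congrFun (hu.torusPartial_torusPartial_sub hv hz.1 i j) z.2

theorem hasDerivAt_excessEnergy (hu : IsC12 u) (K : ℝ) (ht : 0 < t) :
    HasDerivAt (fun s => excessEnergy K (u s))
      (∫ x, 3 * (u t x - K)⁺ ^ 2 * deriv (fun s => u s x) t) t := by
  have hc : Continuous fun s : ℝ => (s - K)⁺ := continuous_posPart.comp (by fun_prop)
  have hcube (s : ℝ) : HasDerivAt (fun r => (r - K)⁺ ^ 3) (3 * (s - K)⁺ ^ 2) s :=
    ((hasDerivAt_posPart_pow 1 (s - K)).comp_sub_const s K).congr_deriv (by norm_num)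
  exact hasDerivAt_integral_of_continuousOn_of_compactSpace isOpen_Ioi
    ((hc.pow 3).comp_continuousOn hu.cont)
    ((((hc.pow 2).const_mul 3).comp_continuousOn hu.cont).mul hu.cont_t)
    (fun s hs x => (hcube _).comp s (hu.diff_t s hs x).hasDerivAt) ht

theorem integral_posPart_sq_mul_deriv_le (hu : IsC12 u) {κ K L : ℝ} (hκ : 0 ≤ κ) (ht : 0 < t)
    (hsub : ∀ x, K < u t x →
      deriv (fun s => u s x) t ≤ κ * torusLaplacian (u t) x + L * (u t x - K)) :
    ∫ x, 3 * (u t x - K)⁺ ^ 2 * deriv (fun s => u s x) t ≤ 3 * L * excessEnergy K (u t) := by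
  have hc : Continuous fun s : ℝ => (s - K)⁺ := continuous_posPart.comp (by fun_prop)
  have cw : Continuous fun x => (u t x - K)⁺ := hc.comp (hu.continuous ht)
  have cΔ := hu.continuous_torusLaplacian ht
  have ct := continuous_slice hu.cont_t ht
  have hsq (s : ℝ) : HasDerivAt (fun r => 3 * (r - K)⁺ ^ 2) (6 * (s - K)⁺) s :=
    (((hasDerivAt_posPart_pow 0 (s - K)).comp_sub_const s K).const_mul 3).congr_deriv
      (by norm_num; ring)
  have dissipation : ∫ x, 3 * (u t x - K)⁺ ^ 2 * torusLaplacian (u t) x ≤ 0 :=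
    integral_comp_mul_torusLaplacian_nonpos (hu.isC1Along ht)
      (fun i => hu.isC1Along_torusPartial ht i i) hsq (by fun_prop) (fun s => by positivity)
  have pointwise (x : Torus d) : 3 * (u t x - K)⁺ ^ 2 * deriv (fun s => u s x) t ≤
      κ * (3 * (u t x - K)⁺ ^ 2 * torusLaplacian (u t) x) + 3 * L * (u t x - K)⁺ ^ 3 := by
    rcases le_or_gt (u t x) K with h | h
    · simp [posPart_of_nonpos (sub_nonpos.2 h)]
    · rw [posPart_of_nonneg (sub_pos.2 h).le]
      linear_combination 3 * (u t x - K) ^ 2 * hsub x h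
  calc ∫ x, 3 * (u t x - K)⁺ ^ 2 * deriv (fun s => u s x) t
      ≤ ∫ x, (κ * (3 * (u t x - K)⁺ ^ 2 * torusLaplacian (u t) x) + 3 * L * (u t x - K)⁺ ^ 3) :=
        integral_mono (integrable_of_continuous_of_compactSpace (by fun_prop))
          (integrable_of_continuous_of_compactSpace (by fun_prop)) pointwise
    _ = κ * (∫ x, 3 * (u t x - K)⁺ ^ 2 * torusLaplacian (u t) x) +
          3 * L * excessEnergy K (u t) := by
        rw [integral_add (integrable_of_continuous_of_compactSpace (by fun_prop))
          (integrable_of_continuous_of_compactSpace (by fun_prop)), integral_const_mul,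
          integral_const_mul, excessEnergy]
    _ ≤ 3 * L * excessEnergy K (u t) :=
        add_le_of_nonpos_left (mul_nonpos_of_nonneg_of_nonpos hκ dissipation)

end IsC12

namespace IsClassicalComponent

variable {d : ℕ} {u v : ℝ → Torus d → ℝ}

theorem neg (hu : IsClassicalComponent u) : IsClassicalComponent fun t x => -u t x where
  regular := hu.regular.neg
  locally_bounded := by simpa only [abs_neg] using hu.locally_bounded
  initial := hu.initial.congr fun t => by
    simpa only [neg_sub_neg, Pi.sub_def] using eLpNorm_sub_comm (u t) (u 0) 1 volume

theorem sub (hu : IsClassicalComponent u) (hv : IsClassicalComponent v)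
    (hu0 : AEStronglyMeasurable (u 0)) (hv0 : AEStronglyMeasurable (v 0)) :
    IsClassicalComponent fun t x => u t x - v t x where
  regular := hu.regular.sub hv.regular
  locally_bounded T := by
    obtain ⟨M, hM⟩ := hu.locally_bounded T
    obtain ⟨N, hN⟩ := hv.locally_bounded T
    exact ⟨M + N, fun t ht x => (abs_sub _ _).trans (add_le_add (hM t ht x) (hN t ht x))⟩
  initial := by
    have hlim := hu.initial.add hv.initial
    rw [add_zero] at hlim
    refine tendsto_of_tendsto_of_tendsto_of_le_of_le' tendsto_const_nhds hlim
      (Eventually.of_forall fun _ => zero_le) ?_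
    filter_upwards [self_mem_nhdsWithin] with t ht
    have hut := (hu.regular.continuous ht).aestronglyMeasurable (μ := volume)
    have hvt := (hv.regular.continuous ht).aestronglyMeasurable (μ := volume)
    refine le_of_eq_of_le ?_ (eLpNorm_sub_le (hut.sub hu0) (hvt.sub hv0) le_rfl)
    exact congrArg (eLpNorm · 1 volume) (funext fun x => sub_sub_sub_comm _ _ _ _)

theorem tendsto_excessEnergy (hu : IsClassicalComponent u) {K : ℝ} (h0 : ∀ᵐ x, u 0 x ≤ K) :
    Tendsto (fun t => excessEnergy K (u t)) (𝓝[>] 0) (𝓝 0) := by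
  obtain ⟨M, hM⟩ := hu.locally_bounded 1
  have hlim : Tendsto
      (fun t => ENNReal.ofReal ((M + |K|) ^ 2) * eLpNorm (fun x => u t x - u 0 x) 1 volume)
      (𝓝[>] 0) (𝓝 0) := by
    simpa using ENNReal.Tendsto.const_mul hu.initial (.inr ENNReal.ofReal_ne_top)
  refine squeeze_zero' (Eventually.of_forall fun t => integral_nonneg fun x => by positivity) ?_
    ((ENNReal.tendsto_toReal ENNReal.zero_ne_top).comp hlim)
  filter_upwards [hlim.eventually_lt_const ENNReal.zero_lt_top, Ioc_mem_nhdsGT zero_lt_one]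
    with t hfin ht
  have hc : Continuous fun x => (u t x - K)⁺ ^ 3 :=
    (continuous_posPart.comp ((hu.regular.continuous ht.1).sub continuous_const)).pow 3
  rw [Function.comp_apply, ← ENNReal.ofReal_le_iff_le_toReal hfin.ne, excessEnergy,
    ofReal_integral_eq_lintegral_ofReal (integrable_of_continuous_of_compactSpace hc)
      (ae_of_all _ fun x => by positivity),
    eLpNorm_one_eq_lintegral_enorm, ← lintegral_const_mul' _ _ ENNReal.ofReal_ne_top]
  refine lintegral_mono_ae ?_
  filter_upwards [h0] with x hx
  rw [Real.enorm_eq_ofReal_abs, ← ENNReal.ofReal_mul (by positivity), pow_succ]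
  refine ENNReal.ofReal_le_ofReal ?_
  have posPart_le_abs (r : ℝ) : r⁺ ≤ |r| := sup_le (le_abs_self r) (abs_nonneg r)
  have bounded : (u t x - K)⁺ ≤ M + |K| :=
    (posPart_le_abs _).trans ((abs_sub _ _).trans (add_le_add_left (hM t ht x) _))
  have le_increment : (u t x - K)⁺ ≤ |u t x - u 0 x| :=
    (posPart_mono (sub_le_sub_left hx _)).trans (posPart_le_abs _)
  gcongr

theorem le_of_initial_le (hu : IsClassicalComponent u) {κ K L t : ℝ} (hκ : 0 ≤ κ)
    (h0 : ∀ᵐ x, u 0 x ≤ K) (ht : 0 < t)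
    (hsub : ∀ s ∈ Ioc 0 t, ∀ x, K < u s x →
      deriv (fun r => u r x) s ≤ κ * torusLaplacian (u s) x + L * (u s x - K))
    (x : Torus d) : u t x ≤ K :=
  le_of_excessEnergy_nonpos (hu.regular.continuous ht)
    (nonpos_of_hasDerivAt_le_mul_of_tendsto_zero ht
      (fun _ hs => hu.regular.hasDerivAt_excessEnergy K hs.1)
      (fun s hs => hu.regular.integral_posPart_sq_mul_deriv_le hκ hs.1 (hsub s hs))
      (hu.tendsto_excessEnergy h0)) x

theorem le_of_le_initial (hu : IsClassicalComponent u) {κ K L t : ℝ} (hκ : 0 ≤ κ)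
    (h0 : ∀ᵐ x, K ≤ u 0 x) (ht : 0 < t)
    (hsuper : ∀ s ∈ Ioc 0 t, ∀ x, u s x < K →
      κ * torusLaplacian (u s) x + L * (u s x - K) ≤ deriv (fun r => u r x) s)
    (x : Torus d) : K ≤ u t x := by
  refine neg_le_neg_iff.1 (hu.neg.le_of_initial_le (K := -K) (L := L) hκ
    (h0.mono fun x => neg_le_neg) ht (fun s hs x hx => ?_) x)
  rw [deriv.fun_neg, torusLaplacian_neg]
  linarith [hsuper s hs x (neg_lt_neg_iff.1 hx)]

end IsClassicalComponent

namespace IsGlobalSolution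

variable {d : ℕ} {κ : ℝ} {k n p e : ℝ → Torus d → ℝ}

theorem swap (h : IsGlobalSolution κ k n p e) : IsGlobalSolution κ k p n e where
  comp_n := h.comp_p
  comp_p := h.comp_n
  comp_e := h.comp_e
  eq_n t ht x := by rw [h.eq_p t ht x, mul_comm (p t x)]
  eq_p t ht x := by rw [h.eq_n t ht x, mul_comm (p t x)]
  eq_e := h.eq_e

theorem e_le (h : IsGlobalSolution κ k n p e) (hκ : 0 ≤ κ) {B : ℝ} (h0 : ∀ᵐ x, e 0 x ≤ B)
    {t : ℝ} (ht : 0 < t) (x : Torus d) : e t x ≤ B :=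
  h.comp_e.le_of_initial_le (L := 0) hκ h0 ht (fun s hs x _ => by simp [h.eq_e s hs.1 x]) x

theorem le_e (h : IsGlobalSolution κ k n p e) (hκ : 0 ≤ κ) {B : ℝ} (h0 : ∀ᵐ x, B ≤ e 0 x)
    {t : ℝ} (ht : 0 < t) (x : Torus d) : B ≤ e t x :=
  h.comp_e.le_of_le_initial (L := 0) hκ h0 ht (fun s hs x _ => by simp [h.eq_e s hs.1 x]) x

theorem n_sub_p_le (h : IsGlobalSolution κ k n p e) (hκ : 0 ≤ κ)
    (hn0 : AEStronglyMeasurable (n 0)) (hp0 : AEStronglyMeasurable (p 0))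
    {A : ℝ} (h0 : ∀ᵐ x, n 0 x - p 0 x ≤ A) {t : ℝ} (ht : 0 < t) (x : Torus d) :
    n t x - p t x ≤ A := by
  have hn := h.comp_n.regular
  have hp := h.comp_p.regular
  refine (h.comp_n.sub h.comp_p hn0 hp0).le_of_initial_le (L := 0) hκ h0 ht
    (fun s hs x _ => le_of_eq ?_) x
  rw [hn.deriv_sub hp hs.1, hn.torusLaplacian_sub hp hs.1, h.eq_n s hs.1, h.eq_p s hs.1]
  ring

theorem n_nonneg (h : IsGlobalSolution κ k n p e) (hκ : 0 ≤ κ)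
    (hk : ∀ t > 0, ∀ x, 0 ≤ k t x) (hk_bdd : ∀ T, ∃ M, ∀ t ∈ Ioc 0 T, ∀ x, k t x ≤ M)
    (he : ∀ t > 0, ∀ x, 0 ≤ e t x) (h0 : ∀ᵐ x, 0 ≤ n 0 x) {t : ℝ} (ht : 0 < t) (x : Torus d) :
    0 ≤ n t x := by
  obtain ⟨M, hM⟩ := hk_bdd t
  obtain ⟨P, hP⟩ := h.comp_p.locally_bounded t
  refine h.comp_n.le_of_le_initial (L := M * P) hκ h0 ht (fun s hs x hx => ?_) x
  have hk_nonneg := hk s hs.1 x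
  have hP_nonneg : 0 ≤ P := (abs_nonneg _).trans (hP s hs x)
  have hkp : k s x * -p s x ≤ M * P :=
    mul_le_mul_of_nonneg (hM s hs x) ((neg_le_abs _).trans (hP s hs x)) hk_nonneg hP_nonneg
  rw [h.eq_n s hs.1 x]
  linarith [mul_nonneg hk_nonneg (he s hs.1 x), mul_le_mul_of_nonpos_right hkp hx.le]

theorem n_le (h : IsGlobalSolution κ k n p e) (hκ : 0 ≤ κ) (hk : ∀ t > 0, ∀ x, 0 ≤ k t x)
    {A B : ℝ} (hA : 0 ≤ A) (hB : 0 ≤ B) (he : ∀ t > 0, ∀ x, e t x ≤ B)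
    (hnp : ∀ t > 0, ∀ x, n t x - p t x ≤ A) (h0 : ∀ᵐ x, n 0 x ≤ A)
    {t : ℝ} (ht : 0 < t) (x : Torus d) : n t x ≤ A + √B := by
  have hsqrt := Real.sqrt_nonneg B
  refine h.comp_n.le_of_initial_le (L := 0) hκ
    (h0.mono fun x hx => hx.trans (le_add_of_nonneg_right hsqrt)) ht (fun s hs x hx => ?_) x
  have hp : √B ≤ p s x := by linarith [hnp s hs.1 x]
  have e_le_np : e s x ≤ n s x * p s x := calc
    e s x ≤ √B * √B := (he s hs.1 x).trans_eq (Real.mul_self_sqrt hB).symm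
    _ ≤ n s x * p s x := mul_le_mul (by linarith) hp hsqrt (by linarith)
  rw [h.eq_n s hs.1 x]
  linarith [mul_nonneg (hk s hs.1 x) (sub_nonneg.2 e_le_np)]

theorem exists_ae_abs_n_le (h : IsGlobalSolution κ k n p e) (hκ : 0 ≤ κ)
    (hk : ∀ t > 0, ∀ x, 0 ≤ k t x) (hk_bdd : ∀ T, ∃ M, ∀ t ∈ Ioc 0 T, ∀ x, k t x ≤ M)
    (hn0 : MemLp (n 0) ⊤) (hp0 : AEStronglyMeasurable (p 0)) (he0 : MemLp (e 0) ⊤)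
    (hn0_nonneg : ∀ᵐ x, 0 ≤ n 0 x) (hp0_nonneg : ∀ᵐ x, 0 ≤ p 0 x)
    (he0_nonneg : ∀ᵐ x, 0 ≤ e 0 x) : ∃ K, ∀ t ≥ 0, ∀ᵐ x, |n t x| ≤ K := by
  set A := lpNorm (n 0) ⊤ volume
  set B := lpNorm (e 0) ⊤ volume
  have hn0_le : ∀ᵐ x, n 0 x ≤ A :=
    (ae_le_lpNorm_exponent_top hn0).mono fun x => (le_abs_self _).trans
  have he0_le : ∀ᵐ x, e 0 x ≤ B :=
    (ae_le_lpNorm_exponent_top he0).mono fun x => (le_abs_self _).trans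
  have hnp : ∀ t > 0, ∀ x, n t x - p t x ≤ A := fun t => h.n_sub_p_le hκ hn0.1 hp0 <| by
    filter_upwards [hn0_le, hp0_nonneg] with x hn hp using (sub_le_self _ hp).trans hn
  have n_nonneg : ∀ t > 0, ∀ x, 0 ≤ n t x := fun t =>
    h.n_nonneg hκ hk hk_bdd (fun s => h.le_e hκ he0_nonneg) hn0_nonneg
  have n_le : ∀ t > 0, ∀ x, n t x ≤ A + √B := fun t =>
    h.n_le hκ hk lpNorm_nonneg lpNorm_nonneg (fun s => h.e_le hκ he0_le) hnp hn0_le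
  refine ⟨A + √B, fun t ht => ?_⟩
  rcases ht.eq_or_lt with rfl | ht
  · filter_upwards [ae_le_lpNorm_exponent_top hn0] with x hx
    exact hx.trans (le_add_of_nonneg_right (Real.sqrt_nonneg B))
  · exact ae_of_all _ fun x => (abs_of_nonneg (n_nonneg t ht x)).trans_le (n_le t ht x)

end IsGlobalSolution

theorem eLpNorm_torus_le_of_ae_bound {d : ℕ} {f : Torus d → ℝ} {K : ℝ} (hf : ∀ᵐ x, |f x| ≤ K)
    (q : ENNReal) : eLpNorm f q volume ≤ ENNReal.ofReal K := by
  simpa only [torus_volume_univ, ENNReal.one_rpow, one_mul] using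
    eLpNorm_le_of_ae_bound (p := q) (hf.mono fun x => (Real.norm_eq_abs (f x)).trans_le)

theorem lemma5p1_general {d : ℕ} {κ : ℝ} {k n p e : ℝ → Torus d → ℝ} (hκ : 0 ≤ κ)
    (hk : ∀ t > 0, ∀ x, 0 ≤ k t x) (hk_bdd : ∀ T, ∃ M, ∀ t ∈ Ioc 0 T, ∀ x, k t x ≤ M)
    (hsol : IsGlobalSolution κ k n p e)
    (hn0 : MemLp (n 0) ⊤) (hp0 : MemLp (p 0) ⊤) (he0 : MemLp (e 0) ⊤)
    (hn0_nonneg : ∀ᵐ x, 0 ≤ n 0 x) (hp0_nonneg : ∀ᵐ x, 0 ≤ p 0 x)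
    (he0_nonneg : ∀ᵐ x, 0 ≤ e 0 x) (q : ENNReal) :
    (⨆ (t : ℝ) (_ : 0 ≤ t), (eLpNorm (n t) q volume + eLpNorm (p t) q volume)) < ⊤ := by
  obtain ⟨N, hN⟩ :=
    hsol.exists_ae_abs_n_le hκ hk hk_bdd hn0 hp0.1 he0 hn0_nonneg hp0_nonneg he0_nonneg
  obtain ⟨P, hP⟩ :=
    hsol.swap.exists_ae_abs_n_le hκ hk hk_bdd hp0 hn0.1 he0 hp0_nonneg hn0_nonneg he0_nonneg
  calc ⨆ (t : ℝ) (_ : 0 ≤ t), (eLpNorm (n t) q volume + eLpNorm (p t) q volume)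
      ≤ ENNReal.ofReal N + ENNReal.ofReal P := iSup₂_le fun t ht =>
        add_le_add (eLpNorm_torus_le_of_ae_bound (hN t ht) q)
          (eLpNorm_torus_le_of_ae_bound (hP t ht) q)
    _ < ⊤ := ENNReal.add_lt_top.2 ⟨ENNReal.ofReal_lt_top, ENNReal.ofReal_lt_top⟩

theorem lemma5p1 {d : ℕ} (κ kLow kUp eLow eUp c C₀ E₀ Cn Cp : ℝ)
    (k n p e : ℝ → Torus d → ℝ)
    (hκ : 0 < κ) (hc : 0 ≤ c)
    -- the reaction coefficient is bounded from above and away from zero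
    (hkLow : 0 < kLow) (hk : ∀ t > 0, ∀ x, kLow ≤ k t x ∧ k t x ≤ kUp)
    (hsol : IsGlobalSolution κ k n p e)
    -- nonnegative bounded initial data
    (hn0 : MemLp (n 0) ⊤ volume) (hp0 : MemLp (p 0) ⊤ volume) (he0 : MemLp (e 0) ⊤ volume)
    (hn0_nonneg : ∀ᵐ x, 0 ≤ n 0 x) (hp0_nonneg : ∀ᵐ x, 0 ≤ p 0 x)
    -- the initial energy lies between positive constants
    (heLow : 0 < eLow) (he0_bounds : ∀ᵐ x, eLow ≤ e 0 x ∧ e 0 x ≤ eUp)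
    -- the values of the conserved quantities
    (hC₀ : ∫ x, (n 0 x - p 0 x) = C₀) (hE₀ : ∫ x, e 0 x = E₀)
    -- the weights of the equilibrium `(Cn √E₀, Cp √E₀, E₀)` with the same conserved quantities
    (hCn : 0 < Cn) (hCp : Cn * Cp = 1) (hCnCp : Cn - Cp = C₀ / √E₀)
    -- finite initial relative entropy
    (hH : relEntropy c Cn Cp E₀ (n 0) (p 0) (e 0) < ⊤) :
    (⨆ (t : ℝ) (_ : 0 ≤ t), (eLpNorm (n t) 1 volume + eLpNorm (p t) 1 volume)) < ⊤ :=
  lemma5p1_general hκ.le (fun t ht x => hkLow.le.trans (hk t ht x).1)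
    (fun _ => ⟨kUp, fun t ht x => (hk t ht.1 x).2⟩) hsol hn0 hp0 he0 hn0_nonneg hp0_nonneg
    (he0_bounds.mono fun _ hx => heLow.le.trans hx.1) 1
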